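/- Let $n,p$ be nonnegative integers with $n-p-1>0$. For $M\in\mathbb{R}^{n\times p}$, let $X\in\mathbb{R}^{n\times p}$ be a random matrix whose entries $X_{ai}\sim \mathrm{N}(M_{ai},1)$ are independent, and write $\mathrm{E}_M$ for expectation under this law. For an estimator $\hat M=\hat M(X)$ of $M$, the matrix quadratic risk is the $p\times p$ matrix $$R(M,\hat M)=\mathrm{E}_M\big[(\hat M(X)-M)^{\top}(\hat M(X)-M)\big],$$ the expectation being taken entrywise. Let $$\hat M_{\mathrm{EM}}=X\left(I_p-(n-p-1)(X^{\top}X)^{-1}\right)$$ be the Efron–Morris estimator. Then at $M=O$ the matrix $X^{\top}X$ is almost surely invertible, the expectations defining the entries of $R(O,\hat M_{\mathrm{EM}})$ exist and are finite, and $$R(O,\hat M_{\mathrm{EM}})=(p+1)I_p .$$ -/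

import Mathlib

open MeasureTheory ProbabilityTheory
open scoped Matrix

/-- Real matrices carry the product (Borel) sigma-algebra of their entries. -/
instance matrixMeasurableSpace {n p : ℕ} : MeasurableSpace (Matrix (Fin n) (Fin p) ℝ) :=
  inferInstanceAs (MeasurableSpace (Fin n → Fin p → ℝ))

/-- The matrix-variate normal law `N_{n,p}(M, I_n, I_p)`: the law of a random `n × p` matrix whose
entries `X_{ai}` are independent with `X_{ai} ∼ N(M_{ai}, 1)`. -/
noncomputable def matrixNormal {n p : ℕ} (M : Matrix (Fin n) (Fin p) ℝ) :
    Measure (Matrix (Fin n) (Fin p) ℝ) :=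
  Measure.pi fun a : Fin n => Measure.pi fun i : Fin p => gaussianReal (M a i) 1

/-- The matrix quadratic loss `L(M, M̂) = (M̂ - M)ᵀ (M̂ - M)`. -/
def matrixQuadraticLoss {n p : ℕ} (M Mhat : Matrix (Fin n) (Fin p) ℝ) :
    Matrix (Fin p) (Fin p) ℝ :=
  (Mhat - M)ᵀ * (Mhat - M)

/-- The loss of the estimator `est` at `M` has a finite expectation, entry by entry, under
`X ∼ N_{n,p}(M, I_n, I_p)`. -/
def HasFiniteMatrixQuadraticRisk {n p : ℕ} (M : Matrix (Fin n) (Fin p) ℝ)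
    (est : Matrix (Fin n) (Fin p) ℝ → Matrix (Fin n) (Fin p) ℝ) : Prop :=
  ∀ i j : Fin p, Integrable (fun X => matrixQuadraticLoss M (est X) i j) (matrixNormal M)

/-- The matrix quadratic risk `R(M, M̂) = E_M[L(M, M̂(X))]`, a `p × p` matrix of expectations. -/
noncomputable def matrixQuadraticRisk {n p : ℕ} (M : Matrix (Fin n) (Fin p) ℝ)
    (est : Matrix (Fin n) (Fin p) ℝ → Matrix (Fin n) (Fin p) ℝ) : Matrix (Fin p) (Fin p) ℝ :=
  Matrix.of fun i j => ∫ X, matrixQuadraticLoss M (est X) i j ∂(matrixNormal M)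

/-- The Efron–Morris estimator `X (I_p - (n - p - 1) (Xᵀ X)⁻¹)`. -/
noncomputable def efronMorris {n p : ℕ} (X : Matrix (Fin n) (Fin p) ℝ) :
    Matrix (Fin n) (Fin p) ℝ :=
  X * (1 - ((n : ℝ) - (p : ℝ) - 1) • (Xᵀ * X)⁻¹)

/-! With c = n - p - 1, the loss at the origin expands to XᵀX - 2cI + c²(XᵀX)⁻¹. A diagonal entry of
XᵀX has mean n. The matching entry of the inverse is the inverse squared distance from a column to
the span of the others (`inv_gram_apply_self`). Given the other columns, that squared distance is
chi-squared with n - p + 1 degrees of freedom, so its inverse has mean 1/c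
(`lintegral_inv_gram_apply_self`). The diagonal risk is therefore n - 2c + c = p + 1.

Off-diagonal entries vanish by symmetry: changing the sign of one column preserves the law and
negates the entry (`integral_loss_apply_of_ne`). No Wishart density is needed. -/

/-! ### Inverse moments of chi-squared variables -/

open Real Set in
/-- The Laplace transform of the square of a standard normal variable. -/
theorem integral_exp_neg_mul_sq_gaussianReal {t : ℝ} (ht : 0 ≤ t) :
    ∫ x, rexp (-t * x ^ 2) ∂(gaussianReal 0 1) = √(1 / (1 + 2 * t)) := by
  rw [integral_gaussianReal_eq_integral_smul (by simp)]
  have h : ∀ x : ℝ, gaussianPDFReal 0 1 x • rexp (-t * x ^ 2) =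
      (√(2 * π))⁻¹ * rexp (-(1 / 2 + t) * x ^ 2) := by
    intro x
    simp only [gaussianPDFReal, smul_eq_mul, NNReal.coe_one, mul_one, sub_zero, mul_assoc,
      ← Real.exp_add]
    ring_nf
  simp_rw [h]
  rw [integral_const_mul, integral_gaussian, ← Real.sqrt_inv, ← Real.sqrt_mul (by positivity)]
  congr 1
  have := Real.pi_ne_zero
  field_simp

open Real Set in
theorem lintegral_exp_neg_mul_Ioi {s : ℝ} (hs : 0 < s) :
    ∫⁻ t in Ioi (0 : ℝ), ENNReal.ofReal (rexp (-t * s)) = ENNReal.ofReal s⁻¹ := by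
  have h1 : ∀ t : ℝ, rexp (-t * s) = rexp ((-s) * t) := fun t => by ring_nf
  simp_rw [h1]
  rw [← ofReal_integral_eq_lintegral_ofReal
    (integrableOn_exp_mul_Ioi (by linarith) 0) (ae_of_all _ fun t => (Real.exp_pos _).le),
    integral_exp_mul_Ioi (by linarith) 0]
  simp

-- The integrand is the Laplace transform of a chi-squared variable with `k` degrees of freedom; `2
-- < k` makes the antiderivative vanish at infinity.
open Real Set in
theorem lintegral_sqrt_inv_pow_Ioi {k : ℕ} (hk : 2 < k) :
    ∫⁻ t in Ioi (0 : ℝ), ENNReal.ofReal (√(1 / (1 + 2 * t)) ^ k) =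
      ENNReal.ofReal ((k : ℝ) - 2)⁻¹ := by
  have hk' : (2 : ℝ) < k := by exact_mod_cast hk
  have hpow : ∀ t ∈ Ioi (0 : ℝ), √(1 / (1 + 2 * t)) ^ k = (1 + 2 * t) ^ (-(k / 2 : ℝ)) := by
    intro t ht
    have h0 : (0 : ℝ) < 1 + 2 * t := by have := mem_Ioi.1 ht; linarith
    rw [Real.sqrt_eq_rpow, ← Real.rpow_natCast, ← Real.rpow_mul (by positivity), one_div,
      Real.inv_rpow h0.le, ← Real.rpow_neg h0.le]
    congr 1; ring
  have hderiv : ∀ t ∈ Ici (0 : ℝ),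
      HasDerivAt (fun t : ℝ => -((k : ℝ) - 2)⁻¹ * (1 + 2 * t) ^ (1 - (k / 2 : ℝ)))
        ((1 + 2 * t) ^ (-(k / 2 : ℝ))) t := by
    intro t ht
    have h0 : (0 : ℝ) < 1 + 2 * t := by have := mem_Ici.1 ht; linarith
    have h1 : HasDerivAt (fun t : ℝ => 1 + 2 * t) 2 t := by
      simpa using ((hasDerivAt_id t).const_mul 2).const_add 1
    have h2 := (h1.rpow_const (p := 1 - (k / 2 : ℝ)) (Or.inl h0.ne')).const_mul
      (-((k : ℝ) - 2)⁻¹)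
    refine h2.congr_deriv ?_
    rw [show 1 - (k / 2 : ℝ) - 1 = -(k / 2 : ℝ) by ring]
    have : (k : ℝ) - 2 ≠ 0 := by linarith
    field_simp
    ring
  have hlim : Filter.Tendsto
      (fun t : ℝ => -((k : ℝ) - 2)⁻¹ * (1 + 2 * t) ^ (1 - (k / 2 : ℝ))) Filter.atTop
      (nhds (-((k : ℝ) - 2)⁻¹ * 0)) := by
    refine Filter.Tendsto.const_mul _ ?_
    rw [show 1 - (k / 2 : ℝ) = -(k / 2 - 1) by ring]
    refine (tendsto_rpow_neg_atTop (by linarith)).comp ?_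
    exact Filter.tendsto_atTop_add_const_left _ _
      (Filter.tendsto_id.const_mul_atTop (by norm_num))
  have hnn : ∀ t ∈ Ioi (0 : ℝ), 0 ≤ (1 + 2 * t) ^ (-(k / 2 : ℝ)) := fun t ht =>
    Real.rpow_nonneg (by have := mem_Ioi.1 ht; linarith) _
  rw [setLIntegral_congr_fun measurableSet_Ioi
    (fun t ht => congrArg ENNReal.ofReal (hpow t ht)), ← ofReal_integral_eq_lintegral_ofReal
    (integrableOn_Ioi_deriv_of_nonneg' hderiv hnn hlim)
    ((ae_restrict_iff' measurableSet_Ioi).2 (ae_of_all _ hnn)),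
    integral_Ioi_of_hasDerivAt_of_nonneg' hderiv hnn hlim]
  simp

theorem ae_ne_zero_pi_gaussianReal {ι : Type*} [Fintype ι] (i : ι) :
    ∀ᵐ x ∂(Measure.pi fun _ : ι => gaussianReal 0 1), x i ≠ 0 := by
  have : NullSingletonClass (gaussianReal 0 1) := nullSingletonClass_gaussianReal (by simp)
  exact (measurePreserving_eval (fun _ : ι => gaussianReal 0 1) i).quasiMeasurePreserving.ae
    (Measure.ae_ne (gaussianReal 0 1) 0)

open Real Set in
/-- The mean of the inverse of a chi-squared variable. -/
theorem lintegral_inv_sum_sq_pi_gaussianReal {ι : Type*} [Fintype ι]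
    (hι : 2 < Fintype.card ι) :
    ∫⁻ x, ENNReal.ofReal (∑ i, x i ^ 2)⁻¹ ∂(Measure.pi fun _ : ι => gaussianReal 0 1) =
      ENNReal.ofReal ((Fintype.card ι : ℝ) - 2)⁻¹ := by
  obtain ⟨i⟩ : Nonempty ι := Fintype.card_pos_iff.1 (by omega)
  have h1 : ∀ᵐ x ∂(Measure.pi fun _ : ι => gaussianReal 0 1),
      ENNReal.ofReal (∑ i, x i ^ 2)⁻¹ =
        ∫⁻ t in Ioi (0 : ℝ), ENNReal.ofReal (rexp (-t * ∑ i, x i ^ 2)) := by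
    filter_upwards [ae_ne_zero_pi_gaussianReal i] with x hx
    refine (lintegral_exp_neg_mul_Ioi ?_).symm
    exact Finset.sum_pos' (fun _ _ => sq_nonneg _) ⟨i, Finset.mem_univ _, by positivity⟩
  -- Tonelli after writing 1/s as the integral of exp(-ts); the inner expectation then factors over
  -- coordinates.
  rw [lintegral_congr_ae h1, lintegral_lintegral_swap (by fun_prop),
    ← lintegral_sqrt_inv_pow_Ioi hι]
  refine setLIntegral_congr_fun measurableSet_Ioi fun t ht => ?_
  have ht0 : 0 ≤ t := (mem_Ioi.1 ht).le
  have hint : Integrable (fun x : ι → ℝ => rexp (-t * ∑ i, x i ^ 2))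
      (Measure.pi fun _ : ι => gaussianReal 0 1) := by
    refine Integrable.of_bound (Measurable.aestronglyMeasurable (by fun_prop)) 1 (ae_of_all _ fun x => ?_)
    rw [Real.norm_eq_abs, Real.abs_exp, Real.exp_le_one_iff]
    have : 0 ≤ ∑ i, x i ^ 2 := Finset.sum_nonneg fun _ _ => sq_nonneg _
    nlinarith
  rw [← ofReal_integral_eq_lintegral_ofReal hint (ae_of_all _ fun x => (Real.exp_pos _).le),
    ← integral_exp_neg_mul_sq_gaussianReal ht0,
    ← integral_fintype_prod_eq_pow (ι := ι) (fun x : ℝ => rexp (-t * x ^ 2))]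
  simp_rw [Finset.mul_sum, Real.exp_sum]

/-! ### Standard Gaussians on Euclidean spaces -/

section StdGaussian

variable {E : Type*} [NormedAddCommGroup E] [InnerProductSpace ℝ E] [FiniteDimensional ℝ E]
  [MeasurableSpace E] [BorelSpace E]

/-- The projection is adjoint to the isometric inclusion of `V`, so the two characteristic functions
agree. -/
theorem stdGaussian_map_orthogonalProjectionOnto (V : Submodule ℝ E) :
    (stdGaussian E).map V.orthogonalProjectionOnto = stdGaussian V := by
  apply Measure.ext_of_charFun
  ext t
  rw [charFun_stdGaussian, charFun_apply, integral_map (by fun_prop) (by fun_prop)]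
  simp_rw [Submodule.inner_orthogonalProjectionOnto_eq_of_mem_right]
  rw [← charFun_apply, charFun_stdGaussian]
  simp

theorem ae_ne_zero_stdGaussian (hE : 0 < Module.finrank ℝ E) :
    ∀ᵐ x ∂(stdGaussian E), x ≠ 0 := by
  rw [stdGaussian, ae_map_iff (p := fun x : E => x ≠ 0)
    (Measurable.aemeasurable (by fun_prop))
    (measurableSet_singleton 0).compl]
  filter_upwards [ae_ne_zero_pi_gaussianReal (⟨0, hE⟩ : Fin (Module.finrank ℝ E))] with x hx h
  refine hx ?_
  exact Fintype.linearIndependent_iff.1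
    (stdOrthonormalBasis ℝ E).orthonormal.linearIndependent x h _

theorem lintegral_inv_norm_sq_stdGaussian (hE : 2 < Module.finrank ℝ E) :
    ∫⁻ x, ENNReal.ofReal (‖x‖ ^ 2)⁻¹ ∂(stdGaussian E) =
      ENNReal.ofReal ((Module.finrank ℝ E : ℝ) - 2)⁻¹ := by
  rw [stdGaussian, lintegral_map (by fun_prop) (by fun_prop)]
  have h : ∀ x : Fin (Module.finrank ℝ E) → ℝ,
      ‖∑ i, x i • stdOrthonormalBasis ℝ E i‖ ^ 2 = ∑ i, x i ^ 2 := fun x => by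
    rw [← real_inner_self_eq_norm_sq,
      (stdOrthonormalBasis ℝ E).orthonormal.inner_sum x x Finset.univ]
    simp [sq]
  simp_rw [h]
  rw [lintegral_inv_sum_sq_pi_gaussianReal (by simpa using hE)]
  simp

end StdGaussian

/-! ### Geometry of the Gram matrix -/

theorem isUnit_det_transpose_mul_self_iff {n p : ℕ} (X : Matrix (Fin n) (Fin p) ℝ) :
    IsUnit (Xᵀ * X).det ↔ LinearIndependent ℝ X.col := by
  rw [← Matrix.isUnit_iff_isUnit_det, ← Matrix.mulVec_injective_iff_isUnit,
    ← Matrix.mulVec_injective_iff]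
  have h := Matrix.ker_mulVecLin_transpose_mul_self X
  rw [← Matrix.coe_mulVecLin, ← Matrix.coe_mulVecLin, ← LinearMap.ker_eq_bot,
    ← LinearMap.ker_eq_bot, h]

/-- The span in Euclidean space of the columns of a matrix. -/
def colSpan {n p : ℕ} (Y : Matrix (Fin n) (Fin p) ℝ) : Submodule ℝ (EuclideanSpace ℝ (Fin n)) :=
  Submodule.span ℝ (Set.range fun j => WithLp.toLp 2 (Y.col j))

/-- The matrix obtained by removing column `i`. -/
def removeCol {n q : ℕ} (i : Fin (q + 1)) (X : Matrix (Fin n) (Fin (q + 1)) ℝ) :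
    Matrix (Fin n) (Fin q) ℝ :=
  Matrix.of fun a j => X a (i.succAbove j)

theorem linearIndependent_toLp_iff {n p : ℕ} (X : Matrix (Fin n) (Fin p) ℝ) :
    LinearIndependent ℝ (fun j => WithLp.toLp 2 (X.col j)) ↔ LinearIndependent ℝ X.col :=
  LinearMap.linearIndependent_iff (WithLp.linearEquiv 2 ℝ (Fin n → ℝ)).symm.toLinearMap
    (LinearEquiv.ker _)

theorem finrank_orthogonal_colSpan {n q : ℕ} {Y : Matrix (Fin n) (Fin q) ℝ}
    (hY : LinearIndependent ℝ Y.col) : Module.finrank ℝ (colSpan Y)ᗮ + q = n := by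
  have h := finrank_span_eq_card ((linearIndependent_toLp_iff Y).2 hY)
  have h2 := (colSpan Y).finrank_add_finrank_orthogonal
  rw [colSpan] at h2 ⊢
  rw [h] at h2
  simp at h2
  omega

theorem linearIndependent_removeCol {n q : ℕ} {X : Matrix (Fin n) (Fin (q + 1)) ℝ}
    (i : Fin (q + 1)) (hX : LinearIndependent ℝ X.col) :
    LinearIndependent ℝ (removeCol i X).col :=
  hX.comp _ i.succAbove_right_injective

theorem linearIndependent_col_of_notMem {n q : ℕ} {X : Matrix (Fin n) (Fin (q + 1)) ℝ}
    (hY : LinearIndependent ℝ (removeCol 0 X).col)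
    (hx : WithLp.toLp 2 (X.col 0) ∉ colSpan (removeCol 0 X)) :
    LinearIndependent ℝ X.col := by
  rw [← linearIndependent_toLp_iff] at hY ⊢
  exact linearIndependent_finSucc.2 ⟨hY, hx⟩

/-- Each diagonal entry of the inverse Gram matrix is the inverse squared distance of the
corresponding column to the span of the others. -/
theorem inv_gram_apply_self {n q : ℕ} {X : Matrix (Fin n) (Fin (q + 1)) ℝ}
    (hX : IsUnit (Xᵀ * X).det) (i : Fin (q + 1)) :
    (Xᵀ * X)⁻¹ i i =
      (‖(colSpan (removeCol i X))ᗮ.orthogonalProjectionOnto (WithLp.toLp 2 (X.col i))‖ ^ 2)⁻¹ := by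
  set V := colSpan (removeCol i X) with hV
  set x : EuclideanSpace ℝ (Fin n) := WithLp.toLp 2 (X.col i) with hx
  set z : Fin (q + 1) → ℝ := (Xᵀ * X)⁻¹ *ᵥ Pi.single i 1 with hz
  -- The dual vector to column `i`: inner product 1 with it and 0 with every other column.
  set y : EuclideanSpace ℝ (Fin n) := WithLp.toLp 2 (X *ᵥ z) with hy
  have hXy : Xᵀ *ᵥ (X *ᵥ z) = Pi.single i 1 := by
    rw [Matrix.mulVec_mulVec, hz, Matrix.mulVec_mulVec, Matrix.mul_nonsing_inv _ hX,
      Matrix.one_mulVec]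
  have hinner : ∀ j, inner ℝ (WithLp.toLp 2 (X.col j)) y = (Pi.single i 1 : Fin (q + 1) → ℝ) j := by
    intro j
    rw [← hXy, hy, EuclideanSpace.inner_toLp_toLp]
    simp [Matrix.mulVec, dotProduct_comm]
    rfl
  have hzi : (Xᵀ * X)⁻¹ i i = z i := by simp [hz]
  have hysum : y = ∑ j, z j • WithLp.toLp 2 (X.col j) := by
    ext a
    simp [hy, Matrix.mulVec, dotProduct, mul_comm]
  have hyV : y ∈ Vᗮ := by
    rw [hV, colSpan, Submodule.mem_orthogonal]
    intro u hu
    induction hu using Submodule.span_induction with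
    | mem u hu =>
      obtain ⟨j, rfl⟩ := hu
      have := hinner (i.succAbove j)
      rwa [Pi.single_eq_of_ne (i.succAbove_ne j)] at this
    | zero => simp
    | add u v _ _ hu hv => rw [inner_add_left, hu, hv, add_zero]
    | smul c u _ hu => rw [inner_smul_left, hu, mul_zero]
  -- `y` is fixed by the projection, which kills every column in its expansion except column `i`.
  have hyy : y = z i • (Vᗮ.orthogonalProjectionOnto x : EuclideanSpace ℝ (Fin n)) := by
    have h1 : (Vᗮ.orthogonalProjectionOnto y : EuclideanSpace ℝ (Fin n)) = y :=
      congrArg Subtype.val (Vᗮ.orthogonalProjectionOnto_mem_subspace_eq_self ⟨y, hyV⟩)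
    rw [← h1, hysum, map_sum, Fin.sum_univ_succAbove _ i, Finset.sum_eq_zero, add_zero, map_smul]
    · rfl
    · intro j _
      rw [map_smul, Submodule.orthogonalProjectionOnto_orthogonal_apply_eq_zero, smul_zero]
      exact Submodule.subset_span ⟨j, rfl⟩
  have hone : z i * ‖Vᗮ.orthogonalProjectionOnto x‖ ^ 2 = 1 := by
    have h1 := hinner i
    rw [Pi.single_eq_same, hyy, inner_smul_right] at h1
    rw [← h1, ← hx, ← real_inner_self_eq_norm_sq,
      Submodule.inner_orthogonalProjectionOnto_eq_of_mem_right, real_inner_comm]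
  rw [hzi]
  exact eq_inv_of_mul_eq_one_left hone

/-! ### Splitting off a column, and the inverse Gram matrix -/

instance isProbabilityMeasure_matrixNormal {n p : ℕ} (M : Matrix (Fin n) (Fin p) ℝ) :
    IsProbabilityMeasure (matrixNormal M) := by
  have h (f : Fin n → Fin p → ℝ) : IsProbabilityMeasure
      (Measure.pi fun a : Fin n => Measure.pi fun i : Fin p => gaussianReal (f a i) 1) :=
    inferInstance
  exact h M

instance matrixBorelSpace {n p : ℕ} : BorelSpace (Matrix (Fin n) (Fin p) ℝ) :=
  inferInstanceAs (BorelSpace (Fin n → Fin p → ℝ))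

theorem measurable_gram_det {n p : ℕ} :
    Measurable fun X : Matrix (Fin n) (Fin p) ℝ => (Xᵀ * X).det :=
  Continuous.measurable (by fun_prop)

theorem measurable_inv_gram_apply {n p : ℕ} (i j : Fin p) :
    Measurable fun X : Matrix (Fin n) (Fin p) ℝ => (Xᵀ * X)⁻¹ i j := by
  have h : ∀ X : Matrix (Fin n) (Fin p) ℝ,
      (Xᵀ * X)⁻¹ i j = ((Xᵀ * X).det)⁻¹ * (Xᵀ * X).adjugate i j := fun X => by
    rw [Matrix.inv_def, Matrix.smul_apply, smul_eq_mul, Ring.inverse_eq_inv']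
  simp_rw [h]
  refine measurable_gram_det.inv.mul (Continuous.measurable ?_)
  exact Continuous.matrix_elem (Continuous.matrix_adjugate (by fun_prop)) i j

/-- Under the standard matrix normal law, a column is independent of the others. -/
theorem measurePreserving_col_removeCol {n q : ℕ} (i : Fin (q + 1)) :
    MeasurePreserving (fun X : Matrix (Fin n) (Fin (q + 1)) ℝ => (removeCol i X, X.col i))
      (matrixNormal 0)
      ((matrixNormal (0 : Matrix (Fin n) (Fin q) ℝ)).prod
        (Measure.pi fun _ : Fin n => gaussianReal 0 1)) := by
  have h1 := measurePreserving_pi (ι := Fin n) _ _ fun _ =>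
    measurePreserving_piFinSuccAbove (fun _ : Fin (q + 1) => gaussianReal 0 1) i
  exact Measure.measurePreserving_swap.comp
    ((measurePreserving_arrowProdEquivProdArrow ℝ (Fin q → ℝ) (Fin n)
      (fun _ => gaussianReal 0 1) (fun _ => Measure.pi fun _ => gaussianReal 0 1)).comp h1)

/-- The matrix obtained by inserting a column at position `i`. -/
def insertCol {n q : ℕ} (i : Fin (q + 1)) (z : Matrix (Fin n) (Fin q) ℝ × (Fin n → ℝ)) :
    Matrix (Fin n) (Fin (q + 1)) ℝ :=
  Matrix.of fun a => i.insertNth (z.2 a) (z.1 a)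

theorem insertCol_col_removeCol {n q : ℕ} (i : Fin (q + 1))
    (X : Matrix (Fin n) (Fin (q + 1)) ℝ) : insertCol i (removeCol i X, X.col i) = X := by
  ext a j
  refine i.succAboveCases ?_ (fun j => ?_) j <;> simp [insertCol, removeCol]

theorem col_insertCol {n q : ℕ} (i : Fin (q + 1)) (x : Fin n → ℝ)
    (Y : Matrix (Fin n) (Fin q) ℝ) : (insertCol i (Y, x)).col i = x := by
  ext a
  simp [insertCol]

theorem removeCol_insertCol {n q : ℕ} (i : Fin (q + 1)) (x : Fin n → ℝ)
    (Y : Matrix (Fin n) (Fin q) ℝ) : removeCol i (insertCol i (Y, x)) = Y := by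
  ext a j
  simp [insertCol, removeCol]

theorem measurable_insertCol {n q : ℕ} (i : Fin (q + 1)) :
    Measurable (insertCol i : Matrix (Fin n) (Fin q) ℝ × (Fin n → ℝ) → _) := by
  refine measurable_pi_lambda _ fun a => measurable_pi_lambda _ fun j => ?_
  refine i.succAboveCases ?_ (fun j => ?_) j
  · simp only [insertCol, Matrix.of_apply, Fin.insertNth_apply_same]
    exact (measurable_pi_apply a).comp measurable_snd
  · simp only [insertCol, Matrix.of_apply, Fin.insertNth_apply_succAbove]
    exact (measurable_pi_apply j).comp ((measurable_pi_apply a).comp measurable_fst)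

theorem measurePreserving_insertCol {n q : ℕ} (i : Fin (q + 1)) :
    MeasurePreserving (insertCol i)
      ((matrixNormal (0 : Matrix (Fin n) (Fin q) ℝ)).prod
        (Measure.pi fun _ : Fin n => gaussianReal 0 1)) (matrixNormal 0) := by
  refine ⟨measurable_insertCol i, ?_⟩
  rw [← (measurePreserving_col_removeCol i).map_eq, Measure.map_map (measurable_insertCol i)
    (measurePreserving_col_removeCol i).measurable]
  convert Measure.map_id using 2
  exact funext fun X => insertCol_col_removeCol i X

theorem measurePreserving_orthogonalProjectionOnto {n : ℕ}
    (V : Submodule ℝ (EuclideanSpace ℝ (Fin n))) :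
    MeasurePreserving (fun x : Fin n → ℝ => V.orthogonalProjectionOnto (WithLp.toLp 2 x))
      (Measure.pi fun _ => gaussianReal 0 1) (stdGaussian V) := by
  refine ⟨by fun_prop, ?_⟩
  rw [← stdGaussian_map_orthogonalProjectionOnto, ← map_pi_eq_stdGaussian,
    Measure.map_map (by fun_prop) (by fun_prop)]
  rfl

/-- Induction on columns: a new Gaussian column almost surely has nonzero projection onto the
orthogonal complement of the earlier span, which has positive dimension. -/
theorem ae_isUnit_det_gram {n p : ℕ} (hp : p ≤ n) :
    ∀ᵐ X ∂(matrixNormal (0 : Matrix (Fin n) (Fin p) ℝ)), IsUnit (Xᵀ * X).det := by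
  induction p with
  | zero => exact ae_of_all _ fun X => by simp
  | succ q ih =>
    have hmeas : MeasurableSet {X : Matrix (Fin n) (Fin (q + 1)) ℝ | IsUnit (Xᵀ * X).det} := by
      simp_rw [isUnit_iff_ne_zero]
      exact measurable_gram_det (measurableSet_singleton 0).compl
    rw [← (measurePreserving_insertCol 0).map_eq,
      ae_map_iff (measurable_insertCol 0).aemeasurable hmeas,
      Measure.ae_prod_iff_ae_ae
        (p := fun z => IsUnit ((insertCol 0 z)ᵀ * insertCol 0 z).det)
        (measurable_insertCol 0 hmeas)]
    filter_upwards [ih (by omega)] with Y hY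
    rw [isUnit_det_transpose_mul_self_iff] at hY
    have hdim := finrank_orthogonal_colSpan hY
    filter_upwards [(measurePreserving_orthogonalProjectionOnto
      (colSpan Y)ᗮ).quasiMeasurePreserving.ae (ae_ne_zero_stdGaussian (by omega))] with x hx
    rw [isUnit_det_transpose_mul_self_iff]
    refine linearIndependent_col_of_notMem (by rwa [removeCol_insertCol]) fun h => hx ?_
    rw [removeCol_insertCol, col_insertCol] at h
    exact Submodule.orthogonalProjectionOnto_orthogonal_apply_eq_zero h

theorem lintegral_inv_gram_apply_self {n p : ℕ} (hnp : p + 1 < n) (i : Fin p) :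
    ∫⁻ X : Matrix (Fin n) (Fin p) ℝ, ENNReal.ofReal ((Xᵀ * X)⁻¹ i i) ∂(matrixNormal 0) =
      ENNReal.ofReal ((n : ℝ) - p - 1)⁻¹ := by
  obtain _ | q := p
  · exact i.elim0
  have hmeas : Measurable fun X : Matrix (Fin n) (Fin (q + 1)) ℝ =>
      ENNReal.ofReal ((Xᵀ * X)⁻¹ i i) := (measurable_inv_gram_apply i i).ennreal_ofReal
  have hae := (measurePreserving_insertCol i).quasiMeasurePreserving.ae
    (ae_isUnit_det_gram (n := n) (p := q + 1) (by omega))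
  have hae2 := Measure.ae_ae_of_ae_prod hae
  rw [← (measurePreserving_insertCol i).lintegral_comp hmeas,
    lintegral_prod
      (fun z => ENNReal.ofReal (((insertCol i z)ᵀ * insertCol i z)⁻¹ i i)) (hmeas.comp (measurable_insertCol i)).aemeasurable]
  have hconst : ∀ᵐ Y ∂(matrixNormal (0 : Matrix (Fin n) (Fin q) ℝ)),
      ∫⁻ x, ENNReal.ofReal (((insertCol i (Y, x))ᵀ * insertCol i (Y, x))⁻¹ i i)
        ∂(Measure.pi fun _ : Fin n => gaussianReal 0 1) =
      ENNReal.ofReal ((n : ℝ) - (q + 1 : ℕ) - 1)⁻¹ := by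
    filter_upwards [hae2] with Y hY
    -- One completion of `Y` to full column rank suffices to show that the columns of `Y` are
    -- independent.
    obtain ⟨x₀, hx₀⟩ := hY.exists
    have hYli := linearIndependent_removeCol i ((isUnit_det_transpose_mul_self_iff _).1 hx₀)
    rw [removeCol_insertCol] at hYli
    have hdim := finrank_orthogonal_colSpan hYli
    have hpt : ∀ᵐ x ∂(Measure.pi fun _ : Fin n => gaussianReal 0 1),
        ENNReal.ofReal (((insertCol i (Y, x))ᵀ * insertCol i (Y, x))⁻¹ i i) =
        ENNReal.ofReal
          (‖(colSpan Y)ᗮ.orthogonalProjectionOnto (WithLp.toLp 2 x)‖ ^ 2)⁻¹ := by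
      filter_upwards [hY] with x hx
      rw [inv_gram_apply_self hx, removeCol_insertCol, col_insertCol]
    rw [lintegral_congr_ae hpt,
      (measurePreserving_orthogonalProjectionOnto (colSpan Y)ᗮ).lintegral_comp
        (f := fun v => ENNReal.ofReal (‖v‖ ^ 2)⁻¹) (by fun_prop),
      lintegral_inv_norm_sq_stdGaussian (by omega)]
    congr 2
    have hdim' : (Module.finrank ℝ (colSpan Y)ᗮ : ℝ) + q = n := by exact_mod_cast hdim
    push_cast
    linarith
  rw [lintegral_congr_ae hconst]
  simp

theorem inv_gram_apply_self_nonneg {n p : ℕ} (X : Matrix (Fin n) (Fin p) ℝ) (i : Fin p) :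
    0 ≤ (Xᵀ * X)⁻¹ i i := by
  have h := (Matrix.posSemidef_conjTranspose_mul_self X).inv.diag_nonneg (i := i)
  rwa [Matrix.conjTranspose_eq_transpose_of_trivial] at h

theorem integrable_inv_gram_apply_self {n p : ℕ} (hnp : p + 1 < n) (i : Fin p) :
    Integrable (fun X : Matrix (Fin n) (Fin p) ℝ => (Xᵀ * X)⁻¹ i i) (matrixNormal 0) := by
  refine ⟨(measurable_inv_gram_apply i i).aestronglyMeasurable, ?_⟩
  rw [hasFiniteIntegral_iff_ofReal (ae_of_all _ fun X => inv_gram_apply_self_nonneg X i),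
    lintegral_inv_gram_apply_self hnp]
  exact ENNReal.ofReal_lt_top

theorem integral_inv_gram_apply_self {n p : ℕ} (hnp : p + 1 < n) (i : Fin p) :
    ∫ X : Matrix (Fin n) (Fin p) ℝ, (Xᵀ * X)⁻¹ i i ∂(matrixNormal 0) =
      ((n : ℝ) - p - 1)⁻¹ := by
  rw [integral_eq_lintegral_of_nonneg_ae (ae_of_all _ fun X => inv_gram_apply_self_nonneg X i)
    (measurable_inv_gram_apply i i).aestronglyMeasurable, lintegral_inv_gram_apply_self hnp,
    ENNReal.toReal_ofReal]
  have : (p : ℝ) + 1 < n := by exact_mod_cast hnp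
  exact inv_nonneg.2 (by linarith)

/-! ### Second moments and the diagonal risk -/

theorem measurePreserving_apply_matrixNormal {n p : ℕ} (a : Fin n) (i : Fin p) :
    MeasurePreserving (fun X : Matrix (Fin n) (Fin p) ℝ => X a i) (matrixNormal 0)
      (gaussianReal 0 1) :=
  (measurePreserving_eval (fun _ : Fin p => gaussianReal 0 1) i).comp
    (measurePreserving_eval (fun _ : Fin n => Measure.pi fun _ : Fin p => gaussianReal 0 1) a)

theorem integrable_sq_gaussianReal : Integrable (fun x : ℝ => x ^ 2) (gaussianReal 0 1) :=
  (memLp_id_gaussianReal 2).integrable_sq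

theorem integral_sq_gaussianReal : ∫ x : ℝ, x ^ 2 ∂(gaussianReal 0 1) = 1 := by
  have h := variance_id_gaussianReal (μ := 0) (v := 1)
  rw [variance_of_integral_eq_zero aemeasurable_id (by simp)] at h
  simpa using h

theorem integrable_gram_apply_self {n p : ℕ} (i : Fin p) :
    Integrable (fun X : Matrix (Fin n) (Fin p) ℝ => (Xᵀ * X) i i) (matrixNormal 0) := by
  simp only [Matrix.mul_apply, Matrix.transpose_apply, ← sq]
  exact integrable_finsetSum _ fun a _ =>
    (measurePreserving_apply_matrixNormal a i).integrable_comp_of_integrable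
      integrable_sq_gaussianReal

theorem integral_gram_apply_self {n p : ℕ} (i : Fin p) :
    ∫ X : Matrix (Fin n) (Fin p) ℝ, (Xᵀ * X) i i ∂(matrixNormal 0) = n := by
  have h : ∀ a : Fin n, ∫ X : Matrix (Fin n) (Fin p) ℝ, X a i ^ 2 ∂(matrixNormal 0) = 1 := by
    intro a
    rw [← integral_sq_gaussianReal, ← (measurePreserving_apply_matrixNormal a i).map_eq,
      integral_map (measurePreserving_apply_matrixNormal a i).measurable.aemeasurable
        (by fun_prop)]
  simp only [Matrix.mul_apply, Matrix.transpose_apply, ← sq]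
  refine (integral_finsetSum Finset.univ fun a _ =>
    (measurePreserving_apply_matrixNormal a i).integrable_comp_of_integrable
      integrable_sq_gaussianReal).trans ?_
  refine (Finset.sum_congr rfl fun a _ => h a).trans ?_
  simp

theorem matrixQuadraticLoss_zero_efronMorris {n p : ℕ} {X : Matrix (Fin n) (Fin p) ℝ}
    (hX : IsUnit (Xᵀ * X).det) :
    matrixQuadraticLoss 0 (efronMorris X) =
      Xᵀ * X - (2 * ((n : ℝ) - p - 1)) • (1 : Matrix (Fin p) (Fin p) ℝ) +
        ((n : ℝ) - p - 1) ^ 2 • (Xᵀ * X)⁻¹ := by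
  set c : ℝ := (n : ℝ) - p - 1
  have hsymm : ((Xᵀ * X)⁻¹)ᵀ = (Xᵀ * X)⁻¹ := by
    rw [Matrix.transpose_nonsing_inv, Matrix.transpose_mul, Matrix.transpose_transpose]
  rw [matrixQuadraticLoss, efronMorris, sub_zero, Matrix.transpose_mul, Matrix.transpose_sub,
    Matrix.transpose_smul, hsymm, Matrix.transpose_one, Matrix.mul_assoc,
    ← Matrix.mul_assoc Xᵀ X]
  generalize hW : Xᵀ * X = W at hX ⊢
  have h1 : W * (1 - c • W⁻¹) = W - c • 1 := by
    rw [mul_sub, mul_one, Matrix.mul_smul, Matrix.mul_nonsing_inv _ hX]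
  rw [h1, sub_mul, one_mul, Matrix.smul_mul, mul_sub, Matrix.nonsing_inv_mul _ hX,
    Matrix.mul_smul, mul_one]
  module

theorem measurable_matrixQuadraticLoss_efronMorris {n p : ℕ} (i j : Fin p) :
    Measurable fun X : Matrix (Fin n) (Fin p) ℝ => matrixQuadraticLoss 0 (efronMorris X) i j := by
  have hentry : ∀ (a : Fin n) (k : Fin p),
      Measurable fun X : Matrix (Fin n) (Fin p) ℝ => efronMorris X a k := by
    intro a k
    suffices h : Measurable fun X : Matrix (Fin n) (Fin p) ℝ => ∑ l, X a l *
        ((1 : Matrix (Fin p) (Fin p) ℝ) l k - ((n : ℝ) - p - 1) * (Xᵀ * X)⁻¹ l k) from h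
    refine Finset.measurable_sum _ fun l _ => Measurable.mul ?_ ?_
    · exact (measurable_pi_apply l).comp (measurable_pi_apply a)
    · exact measurable_const.sub ((measurable_inv_gram_apply l k).const_mul _)
  simp only [matrixQuadraticLoss, sub_zero, Matrix.mul_apply, Matrix.transpose_apply]
  exact Finset.measurable_sum _ fun a _ => (hentry a i).mul (hentry a j)

theorem ae_loss_apply_self {n p : ℕ} (hnp : p + 1 < n) (i : Fin p) :
    (fun X => matrixQuadraticLoss 0 (efronMorris X) i i)
      =ᵐ[matrixNormal (0 : Matrix (Fin n) (Fin p) ℝ)]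
    fun X => (Xᵀ * X) i i - 2 * ((n : ℝ) - p - 1) + ((n : ℝ) - p - 1) ^ 2 * (Xᵀ * X)⁻¹ i i := by
  filter_upwards [ae_isUnit_det_gram (n := n) (p := p) (by omega)] with X hX
  rw [matrixQuadraticLoss_zero_efronMorris hX]
  simp

theorem integrable_loss_apply_self {n p : ℕ} (hnp : p + 1 < n) (i : Fin p) :
    Integrable (fun X => matrixQuadraticLoss 0 (efronMorris X) i i)
      (matrixNormal (0 : Matrix (Fin n) (Fin p) ℝ)) :=
  (((integrable_gram_apply_self i).sub (integrable_const _)).add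
    ((integrable_inv_gram_apply_self hnp i).const_mul _)).congr (ae_loss_apply_self hnp i).symm

theorem integral_loss_apply_self {n p : ℕ} (hnp : p + 1 < n) (i : Fin p) :
    ∫ X, matrixQuadraticLoss 0 (efronMorris X) i i
      ∂(matrixNormal (0 : Matrix (Fin n) (Fin p) ℝ)) = (p : ℝ) + 1 := by
  have hc : (n : ℝ) - p - 1 ≠ 0 := by
    have : (p : ℝ) + 1 < n := by exact_mod_cast hnp
    linarith
  have h1 := integral_gram_apply_self (n := n) i
  have h2 := integral_inv_gram_apply_self hnp i
  have hi1 := integrable_gram_apply_self (n := n) i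
  have hi2 := integrable_inv_gram_apply_self hnp i
  refine (integral_congr_ae (ae_loss_apply_self hnp i)).trans ?_
  refine (integral_add (hi1.sub (integrable_const _)) (hi2.const_mul _)).trans ?_
  rw [integral_const_mul, h2]
  refine (congrArg (· + _) ((integral_sub hi1 (integrable_const _)).trans
    (congrArg (· - _) h1))).trans ?_
  rw [integral_const]
  simp only [probReal_univ, one_smul]
  -- What remains is n - 2c + c² · c⁻¹ = p + 1, with c = n - p - 1.
  field_simp
  ring

/-- Reduces integrability of off-diagonal entries to that of the diagonal ones. -/
theorem abs_matrixQuadraticLoss_apply_le {n p : ℕ} (M Z : Matrix (Fin n) (Fin p) ℝ)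
    (i j : Fin p) :
    |matrixQuadraticLoss M Z i j| ≤ matrixQuadraticLoss M Z i i + matrixQuadraticLoss M Z j j := by
  simp only [matrixQuadraticLoss, Matrix.mul_apply, Matrix.transpose_apply,
    ← Finset.sum_add_distrib]
  refine (Finset.abs_sum_le_sum_abs _ _).trans (Finset.sum_le_sum fun a _ => ?_)
  rw [abs_le]
  constructor <;> nlinarith [sq_nonneg ((Z - M) a i + (Z - M) a j),
    sq_nonneg ((Z - M) a i - (Z - M) a j)]

theorem hasFiniteMatrixQuadraticRisk_efronMorris {n p : ℕ} (hnp : p + 1 < n) :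
    HasFiniteMatrixQuadraticRisk (0 : Matrix (Fin n) (Fin p) ℝ) efronMorris := fun i j =>
  ((integrable_loss_apply_self hnp i).add (integrable_loss_apply_self hnp j)).mono'
    (measurable_matrixQuadraticLoss_efronMorris i j).aestronglyMeasurable
    (ae_of_all _ fun X => abs_matrixQuadraticLoss_apply_le 0 (efronMorris X) i j)

/-! ### Sign symmetry and the off-diagonal risk -/

/-- The diagonal matrix changing the sign of coordinate `i`. -/
def signFlip {p : ℕ} (i : Fin p) : Matrix (Fin p) (Fin p) ℝ :=
  Matrix.diagonal (Function.update 1 i (-1))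

theorem signFlip_mul_self {p : ℕ} (i : Fin p) : signFlip i * signFlip i = 1 := by
  rw [signFlip, Matrix.diagonal_mul_diagonal, ← Matrix.diagonal_one]
  congr 1
  ext j
  by_cases h : j = i
  · subst h; simp
  · simp [h]

theorem signFlip_transpose {p : ℕ} (i : Fin p) : (signFlip i)ᵀ = signFlip i :=
  Matrix.diagonal_transpose _

theorem efronMorris_mul_signFlip {n p : ℕ} (X : Matrix (Fin n) (Fin p) ℝ) (i : Fin p) :
    efronMorris (X * signFlip i) = efronMorris X * signFlip i := by
  have hD := signFlip_mul_self i
  have hinv : (signFlip i)⁻¹ = signFlip i := Matrix.inv_eq_left_inv hD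
  have h1 : (X * signFlip i)ᵀ * (X * signFlip i) = signFlip i * (Xᵀ * X) * signFlip i := by
    simp only [Matrix.transpose_mul, signFlip_transpose, Matrix.mul_assoc]
  rw [efronMorris, efronMorris, h1, Matrix.mul_inv_rev, Matrix.mul_inv_rev, hinv,
    Matrix.mul_assoc, Matrix.mul_assoc, mul_sub, sub_mul, Matrix.mul_smul, Matrix.smul_mul,
    ← mul_assoc (signFlip i) (signFlip i), hD, one_mul, one_mul, mul_one]

theorem matrixQuadraticLoss_zero_mul_signFlip {n p : ℕ} (Z : Matrix (Fin n) (Fin p) ℝ)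
    {i j : Fin p} (hij : i ≠ j) :
    matrixQuadraticLoss 0 (Z * signFlip i) i j = -matrixQuadraticLoss 0 Z i j := by
  rw [matrixQuadraticLoss, matrixQuadraticLoss, sub_zero, sub_zero, Matrix.transpose_mul,
    signFlip_transpose, Matrix.mul_assoc, ← Matrix.mul_assoc Zᵀ, signFlip,
    Matrix.diagonal_mul, Matrix.mul_diagonal]
  simp [Function.update_of_ne hij.symm]

theorem measurePreserving_mul_signFlip {n p : ℕ} (i : Fin p) :
    MeasurePreserving (fun X : Matrix (Fin n) (Fin p) ℝ => X * signFlip i)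
      (matrixNormal 0) (matrixNormal 0) := by
  have hentry : ∀ j : Fin p,
      MeasurePreserving (fun x : ℝ => x * (Function.update 1 i (-1) : Fin p → ℝ) j)
        (gaussianReal 0 1) (gaussianReal 0 1) := by
    intro j
    refine ⟨by fun_prop, ?_⟩
    by_cases h : j = i
    · subst h; simpa using gaussianReal_map_neg (μ := 0) (v := 1)
    · simp [h]
  have h := measurePreserving_pi (ι := Fin n) _ _ fun _ =>
    measurePreserving_pi (ι := Fin p) _ _ hentry
  have hfun : (fun X : Matrix (Fin n) (Fin p) ℝ => X * signFlip i) =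
      fun X a j => X a j * (Function.update 1 i (-1) : Fin p → ℝ) j :=
    funext fun X => Matrix.ext fun a j => Matrix.mul_diagonal _ _ _ _
  rw [hfun]
  exact h

/-- By equivariance of the estimator under `signFlip` and invariance of the law, the integral equals
its own negative. -/
theorem integral_loss_apply_of_ne {n p : ℕ} {i j : Fin p} (hij : i ≠ j) :
    ∫ X, matrixQuadraticLoss 0 (efronMorris X) i j
      ∂(matrixNormal (0 : Matrix (Fin n) (Fin p) ℝ)) = 0 := by
  have hmp := measurePreserving_mul_signFlip (n := n) i
  have h := integral_map (μ := matrixNormal 0) hmp.measurable.aemeasurable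
    (measurable_matrixQuadraticLoss_efronMorris (n := n) i j).aestronglyMeasurable
  simp only [hmp.map_eq, efronMorris_mul_signFlip, matrixQuadraticLoss_zero_mul_signFlip _ hij,
    integral_neg] at h
  linarith

theorem mainTheorem11 (n p : ℕ) (hnp : p + 1 < n) :
    (∀ᵐ X ∂(matrixNormal (0 : Matrix (Fin n) (Fin p) ℝ)), IsUnit (Xᵀ * X).det) ∧
    HasFiniteMatrixQuadraticRisk (0 : Matrix (Fin n) (Fin p) ℝ) efronMorris ∧
    matrixQuadraticRisk (0 : Matrix (Fin n) (Fin p) ℝ) efronMorris =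
      ((p : ℝ) + 1) • (1 : Matrix (Fin p) (Fin p) ℝ) := by
  refine ⟨ae_isUnit_det_gram (by omega), hasFiniteMatrixQuadraticRisk_efronMorris hnp, ?_⟩
  ext i j
  rw [matrixQuadraticRisk, Matrix.of_apply, Matrix.smul_apply, Matrix.one_apply]
  split_ifs with h
  · subst h
    rw [integral_loss_apply_self hnp, smul_eq_mul, mul_one]
  · rw [integral_loss_apply_of_ne h, smul_zero]
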